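/- Let $k$ be a commutative ring containing $\mathbb{Q}$. A sequence of polynomials $q_n(x)\in k[x]$ is said to have $q_n$ of degree $n$ if $\deg q_n=n$ with invertible leading coefficient for all $n\ge 0$ (over a field invertibility is automatic). Such a sequence $p_n$ is of *binomial type* if $p_n(x+y)=\sum_i\binom ni p_i(x)p_{n-i}(y)$ for all $n\ge0$. A sequence $s_n\in k[x]$ with $s_n$ of degree $n$ is *Sheffer with respect to* $p_n$ if there is a delta operator $Q=g(D_x)$ ($g\in k[[t]]$, $g(0)=0$, $g'(0)$ invertible) with $Qp_n=np_{n-1}$ and $Qs_n=ns_{n-1}$ for all $n\ge0$. *Umbral calculus.* Let $F=k[x]$. Umbrae are formal variables $\alpha$ with prescribed moments $E[\alpha^n]\in F$, $E[\alpha^0]=1$, every such moment sequence being represented by infinitely many umbrae. $E$ extends $F$-linearly to polynomials in the umbrae, with $E[\prod\alpha_i^{e_i}]=\prod E[\alpha_i^{e_i}]$ for distinct umbrae $\alpha_i$. Write $u\simeq v$ if $E[u]=E[v]$, and call $u,v$ exchangeable if $u^j\simeq v^j$ for all $j\ge0$. For umbral polynomials $u,v$, the auxiliary umbra $u.v$ is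 a further umbra (distinct from, hence independent of, all non-auxiliary umbrae) with $E[(u.v)^j]=E[q_j(u)]$, where $q_j(n)$ is the coefficient of $z^j/j!$ in $e^{n\log g(z)}$, a polynomial in $n$, and $g(z)=\sum_j E[v^j]z^j/j!$. In the presentations below, all of the umbrae $\beta,\gamma,\alpha,\mu,\mu_i$ have moments in $k$. **Theorem.** Let $p_0(x),p_1(x),\dots\in k[x]$ be of binomial type and let $s_0(x),s_1(x),\dots$ be a sequence of polynomials in $k[x]$. Consider: 1. $s_n$ is Sheffer with respect to $p_n$. 2. There are umbrae $\beta,\gamma$ such that for all $n\ge0$: $p_n(x)\simeq (x.\gamma)^n$ and $s_n(x)\simeq\big((x+\beta).\gamma\big)^n$. 3. There are umbrae $\beta,\alpha$ such that for all $n\ge0$: $p_n(x)\simeq x(x+n.\alpha)^{n-1}$ and $s_n(x)\simeq (x+\beta)(x+\beta+n.\alpha)^{n-1}$, both right sides being read as $1$ for $n=0$. 4. There are umbrae $\beta,\mu$ and distinct umbrae $\mu_1,\mu_2,\dots$, different from $\beta$ and all exchangeable with $\mu$, such that for all $n\ge0$: $p_n(x)\simeq x(x+\mu_1)\cdots(x+\mu_1+\cdots+\mu_{n-1})$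 and $s_n(x)\simeq (x+\beta)(x+\beta+\mu_1)\cdots(x+\beta+\mu_1+\cdots+\mu_{n-1})$ (products of $n$ factors). Then (2) holds if and only if (1) holds and $s_0=1$; (3) holds if and only if (1) holds, $s_0=1$ and $p_1(x)=x$; and (4) holds if and only if (1) holds, $s_0=1$ and $p_1(x)=x$. In particular, if $s_0=1$ and $p_1(x)=x$, then (1)–(4) are equivalent. -/

import Mathlib

noncomputable section

namespace Umbral

/-! ### Evaluation of umbral polynomials -/

section Evaluation

variable {A F : Type*} [CommRing F]

/-- The `F`-linear evaluation map `F[A] → F` on polynomials in umbrae from the alphabet `A` for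
which `mom a n` is the `n`th moment of the umbra `a`: on a monomial it is
`∏ aⁿ ↦ ∏ mom a n`, so that distinct umbrae behave as independent random variables. -/
def evalOf (mom : A → ℕ → F) : MvPolynomial A F →ₗ[F] F :=
  (MvPolynomial.basisMonomials A F).constr F fun e => e.prod mom

theorem evalOf_monomial (mom : A → ℕ → F) (e : A →₀ ℕ) (c : F) :
    evalOf mom (MvPolynomial.monomial e c) = c * e.prod mom := by
  have h : MvPolynomial.monomial e c = c • MvPolynomial.basisMonomials A F e := by
    simp [MvPolynomial.coe_basisMonomials, MvPolynomial.smul_monomial]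
  rw [h, map_smul, evalOf, Module.Basis.constr_basis, smul_eq_mul]

theorem evalOf_C (mom : A → ℕ → F) (c : F) : evalOf mom (MvPolynomial.C c) = c := by
  rw [MvPolynomial.C_apply, evalOf_monomial, Finsupp.prod_zero_index, mul_one]

theorem evalOf_X_pow (mom : A → ℕ → F) (h0 : ∀ a, mom a 0 = 1) (a : A) (n : ℕ) :
    evalOf mom (MvPolynomial.X a ^ n) = mom a n := by
  rw [MvPolynomial.X_pow_eq_monomial, evalOf_monomial, Finsupp.prod_single_index (h0 a), one_mul]

/-- Monomials without a common umbra are independent. -/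
theorem evalOf_monomial_mul (mom : A → ℕ → F) (d e : A →₀ ℕ) (h : Disjoint d.support e.support) :
    evalOf mom (MvPolynomial.monomial d 1 * MvPolynomial.monomial e 1) =
      evalOf mom (MvPolynomial.monomial d 1) * evalOf mom (MvPolynomial.monomial e 1) := by
  classical
  rw [MvPolynomial.monomial_mul, evalOf_monomial, evalOf_monomial, evalOf_monomial,
    Finsupp.prod_add_index_of_disjoint h]
  ring

end Evaluation

/-! ### Umbrae -/

/-- The (non-auxiliary) umbrae over `F`: for each sequence of moments in `F` that starts with `1`
there are infinitely many umbrae representing it, told apart by their labels. -/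
structure Umbra (F : Type*) [CommRing F] where
  /-- the moments of the umbra -/
  moment : ℕ → F
  moment_zero : moment 0 = 1
  /-- a label, distinguishing umbrae with equal moments -/
  label : ℕ

section Alphabet

variable {F : Type*} [CommRing F]

/-- Evaluation of umbral polynomials without auxiliary umbrae. -/
def eval₀ : MvPolynomial (Umbra F) F →ₗ[F] F := evalOf Umbra.moment

variable [Algebra ℚ F]

/-- The power series `g(z) = ∑ E[q ^ k] z ^ k / k!`, i.e. `g(z) ≃ e^{qz}`. -/
def genFun (q : MvPolynomial (Umbra F) F) : PowerSeries F :=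
  PowerSeries.mk fun k => (1 / (k.factorial : ℚ)) • eval₀ (q ^ k)

/-- The polynomial `q_k(n)`, in the indeterminate `n`, that is the coefficient of `z ^ k / k!` in
`e ^ (n log (g(z)))`. -/
def dotPoly (g : PowerSeries F) (k : ℕ) : Polynomial F :=
  (k.factorial : ℚ) • PowerSeries.coeff k
    ((PowerSeries.exp (Polynomial F)).subst
      (PowerSeries.C (Polynomial.X : Polynomial F) *
        PowerSeries.map Polynomial.C (PowerSeries.logOf g)))

variable (F) in
/-- The auxiliary umbrae: the umbra `p . q`, for umbral polynomials `p`, `q` without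
auxiliary umbrae. -/
structure AuxUmbra where
  /-- the left operand of the dot -/
  left : MvPolynomial (Umbra F) F
  /-- the right operand of the dot -/
  right : MvPolynomial (Umbra F) F

/-- The moments of `p . q`, given by `(p . q) ^ k ≃ q_k(p)` where `q_k(n)` is the coefficient of
`z ^ k / k!` in `e ^ (n log (g(z)))` and `g(z) ≃ e ^ (qz)`. -/
def AuxUmbra.moment (d : AuxUmbra F) (k : ℕ) : F :=
  eval₀ (Polynomial.aeval d.left (dotPoly (genFun d.right) k))

variable (F) in
/-- The polynomials over `F` in all umbrae, auxiliary or not. -/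
abbrev UPoly := MvPolynomial (Umbra F ⊕ AuxUmbra F) F

/-- The evaluation map `E`. -/
def E : UPoly F →ₗ[F] F := evalOf (Sum.elim Umbra.moment AuxUmbra.moment)

/-- Umbral equivalence. -/
def UEquiv (p q : UPoly F) : Prop := E p = E q

infix:50 " ≃ᵤ " => UEquiv

/-- Umbral exchangeability. -/
def Exchangeable (p q : UPoly F) : Prop := ∀ k : ℕ, p ^ k ≃ᵤ q ^ k

/-- An element of `F` as an umbral polynomial. -/
def const (c : F) : UPoly F := MvPolynomial.C c

/-- An umbra as an umbral polynomial. -/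
def umb (a : Umbra F) : UPoly F := MvPolynomial.X (Sum.inl a)

/-- The auxiliary umbra `p . q` as an umbral polynomial. -/
def dot (p q : MvPolynomial (Umbra F) F) : UPoly F := MvPolynomial.X (Sum.inr ⟨p, q⟩)

/-- The auxiliary umbra `n . α`. -/
def natDot (n : ℕ) (α : Umbra F) : UPoly F := dot (n : MvPolynomial (Umbra F) F) (MvPolynomial.X α)

/-- The generalized Abel polynomials `z (z + n . α) ^ (n - 1)`, with value `1` for `n = 0`. -/
def abel (α : Umbra F) (z : UPoly F) : ℕ → UPoly F
  | 0 => 1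
  | n + 1 => z * (z + natDot (n + 1) α) ^ n

/-- The generalized rising factorials `z (z + μ₁) (z + μ₁ + μ₂) ⋯ (z + μ₁ + ⋯ + μₙ₋₁)`; here `μ i`
is the umbra usually written with the index `i + 1`. -/
def rising (μ : ℕ → Umbra F) (z : UPoly F) (n : ℕ) : UPoly F :=
  ∏ j ∈ Finset.range n, (z + ∑ i ∈ Finset.range j, umb (μ i))

end Alphabet

/-! ### Polynomial sequences -/

section Sequences

variable {k : Type*} [CommRing k]

/-- An umbra over `k[x]` that represents a sequence in `k`. -/
def Umbra.IsScalar (a : Umbra (Polynomial k)) : Prop :=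
  ∀ n, ∃ c : k, a.moment n = Polynomial.C c

/-- `p n` has degree `n`, with an invertible leading coefficient, for all `n`. Over a field the
second condition follows from the first. -/
def IsGradedSeq (p : ℕ → Polynomial k) : Prop :=
  ∀ n, (p n).degree = n ∧ IsUnit (p n).leadingCoeff

/-- Sequences of binomial type: `p n` has degree `n`, and
`p_n(x + y) = ∑ i, (n choose i) p_i(x) p_{n-i}(y)` in `k[x, y]`. -/
def IsBinomialType (p : ℕ → Polynomial k) : Prop :=
  IsGradedSeq p ∧ ∀ n,
    Polynomial.aeval (MvPolynomial.X 0 + MvPolynomial.X 1 : MvPolynomial (Fin 2) k) (p n) =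
      ∑ i ∈ Finset.range (n + 1), (n.choose i : MvPolynomial (Fin 2) k) *
        (Polynomial.aeval (MvPolynomial.X 0 : MvPolynomial (Fin 2) k) (p i) *
          Polynomial.aeval (MvPolynomial.X 1 : MvPolynomial (Fin 2) k) (p (n - i)))

/-- The operator `g(D)` on polynomials, where `D` is differentiation. -/
def diffOp (g : PowerSeries k) (f : Polynomial k) : Polynomial k :=
  ∑ i ∈ Finset.range (f.natDegree + 1),
    PowerSeries.coeff i g • (Polynomial.derivative^[i] f)

/-- The series `g` for which `g(D)` is a delta operator. -/
def IsDelta (g : PowerSeries k) : Prop :=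
  PowerSeries.coeff 0 g = 0 ∧ IsUnit (PowerSeries.coeff 1 g)

/-- `s` is a Sheffer sequence with respect to `p`: `s n` has degree `n`, and
`Q s_n = n s_{n-1}` for the delta operator `Q = g(D)` associated with `p`,
that is, with `Q p_n = n p_{n-1}`. For `n = 0` the right sides are `0`. -/
def IsSheffer (p s : ℕ → Polynomial k) : Prop :=
  IsGradedSeq s ∧ ∃ g : PowerSeries k, IsDelta g ∧
    (∀ n, diffOp g (p n) = n • p (n - 1)) ∧ (∀ n, diffOp g (s n) = n • s (n - 1))

end Sequences

end Umbral

end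

/-! An umbra `a` added to the argument of a polynomial acts, after evaluation, as the operator
`g(D)`, where `g(z) ≃ e^{az}`: this is the binomial theorem with moments in place of powers
(`evalOf_mul_aeval_add_X`). Hence in all three presentations `β` only applies to `p_n` an operator
`B(D)` with `B(0) = 1`. By `isSheffer_iff`, such images of `p` are exactly the Sheffer sequences
with `s_0 = 1`, so what remains is to present `p` itself.

Binomial type gives `D p_n = ∑ (n choose i) p_i p_{n-i}'(0)`, that is `D P = f(z) P` for `P = ∑ p_n
z^n/n!`, with `P(0, z) = 1`. So `P = e^{x f(z)}`, a series `h(D)` multiplies `P` by `h(f(z))`, and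
the compositional inverse `φ` of `f` is the delta series of `p`.

For (2), take `e^{γz} ≃ e^{f(z)}`. For (3), write `φ = tψ` and take `e^{αz} ≃ 1/ψ`, giving `p_n = x
ψ(D)^{-n} x^{n-1}`. For (4), take `e^{μz} ≃ 1/φ'`, giving `p_{n+1} = x φ'(D)^{-1} p_n`. The last two
rest on the commutator `[h(D), x] = h'(D)` and on the fact that lowering by a delta operator and the
values at `0` determine a sequence. The condition `p_1 = x` means `φ'(0) = 1`, which makes the
zeroth moments of `α` and `μ` equal to `1`. -/

noncomputable section

namespace Umbral

open Polynomial

/-! ### Operators `g(D)` and delta operators -/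

section Operators

variable {k : Type*} [CommRing k]

theorem diffOp_eq_sum (g : PowerSeries k) {f : k[X]} {N : ℕ} (hN : f.natDegree < N) :
    diffOp g f = ∑ i ∈ Finset.range N, PowerSeries.coeff i g • derivative^[i] f := by
  refine Finset.sum_subset (Finset.range_mono hN) fun i _ hi => ?_
  rw [iterate_derivative_eq_zero (by simpa using hi), smul_zero]

theorem diffOp_add (g : PowerSeries k) (f₁ f₂ : k[X]) :
    diffOp g (f₁ + f₂) = diffOp g f₁ + diffOp g f₂ := by
  have h₁ : f₁.natDegree < max f₁.natDegree f₂.natDegree + 1 := by omega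
  have h₂ : f₂.natDegree < max f₁.natDegree f₂.natDegree + 1 := by omega
  have h : (f₁ + f₂).natDegree < max f₁.natDegree f₂.natDegree + 1 :=
    Nat.lt_succ_of_le (natDegree_add_le _ _)
  rw [diffOp_eq_sum g h₁, diffOp_eq_sum g h₂, diffOp_eq_sum g h, ← Finset.sum_add_distrib]
  simp [iterate_map_add]

theorem diffOp_C_mul (g : PowerSeries k) (c : k) (f : k[X]) :
    diffOp g (C c * f) = C c * diffOp g f := by
  have h : (C c * f).natDegree < f.natDegree + 1 := Nat.lt_succ_of_le (natDegree_C_mul_le _ _)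
  rw [diffOp_eq_sum g h, diffOp, Finset.mul_sum]
  simp [iterate_derivative_C_mul]

/-- The operator `g(D)` as a linear map. -/
def diffOpHom (g : PowerSeries k) : k[X] →ₗ[k] k[X] where
  toFun := diffOp g
  map_add' := diffOp_add g
  map_smul' c f := by simpa [smul_eq_C_mul] using diffOp_C_mul g c f

theorem diffOp_zero (g : PowerSeries k) : diffOp g 0 = 0 := (diffOpHom g).map_zero

theorem diffOp_sub (g : PowerSeries k) (f₁ f₂ : k[X]) :
    diffOp g (f₁ - f₂) = diffOp g f₁ - diffOp g f₂ := (diffOpHom g).map_sub f₁ f₂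

theorem diffOp_sum (g : PowerSeries k) {ι : Type*} (t : Finset ι) (f : ι → k[X]) :
    diffOp g (∑ i ∈ t, f i) = ∑ i ∈ t, diffOp g (f i) := map_sum (diffOpHom g) f t

theorem diffOp_nsmul (g : PowerSeries k) (n : ℕ) (f : k[X]) :
    diffOp g (n • f) = n • diffOp g f := map_nsmul (diffOpHom g) n f

theorem diffOp_add_left (g h : PowerSeries k) (f : k[X]) :
    diffOp (g + h) f = diffOp g f + diffOp h f := by
  simp [diffOp, add_smul, Finset.sum_add_distrib]

theorem diffOp_nsmul_left (n : ℕ) (g : PowerSeries k) (f : k[X]) :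
    diffOp (n • g) f = n • diffOp g f := by
  simp [diffOp, Finset.smul_sum, mul_smul, ← Nat.cast_smul_eq_nsmul k]

theorem diffOp_one_left (f : k[X]) : diffOp 1 f = f := by
  rw [diffOp, Finset.sum_eq_single 0]
  · simp
  · intro i _ hi
    simp [PowerSeries.coeff_one, hi]
  · simp

theorem diffOp_X_left (f : k[X]) : diffOp PowerSeries.X f = derivative f := by
  rw [diffOp_eq_sum _ (show f.natDegree < f.natDegree + 2 by omega), Finset.sum_eq_single 1]
  · simp
  · intro i _ hi
    simp [PowerSeries.coeff_X, hi]
  · simp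

theorem natDegree_diffOp_le (g : PowerSeries k) (f : k[X]) :
    (diffOp g f).natDegree ≤ f.natDegree :=
  natDegree_sum_le_of_forall_le _ _ fun i _ => (natDegree_smul_le _ _).trans
    ((natDegree_iterate_derivative f i).trans (Nat.sub_le _ _))

theorem diffOp_mul_left (g h : PowerSeries k) (f : k[X]) :
    diffOp (g * h) f = diffOp g (diffOp h f) := by
  set N := f.natDegree + 1 with hN
  have hlt : f.natDegree < N := by omega
  have hz : ∀ i, N ≤ i → derivative^[i] f = 0 := fun i hi =>
    iterate_derivative_eq_zero (by omega)
  rw [diffOp_eq_sum g ((natDegree_diffOp_le h f).trans_lt hlt), diffOp_eq_sum h hlt,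
    diffOp_eq_sum _ hlt]
  have key : ∀ i j, derivative^[i] (PowerSeries.coeff j h • derivative^[j] f) =
      PowerSeries.coeff j h • derivative^[i + j] f := fun i j => by
    rw [iterate_derivative_smul, ← Function.iterate_add_apply]
  simp only [iterate_derivative_sum, key, PowerSeries.coeff_mul, Finset.sum_smul, Finset.smul_sum,
    smul_smul]
  rw [← Finset.sum_product', Finset.sum_sigma']
  -- The triangle `i + j < N` is matched with the square `i, j < N`; the excess pairs contribute `0`
  -- because `D^{i+j} f = 0` there.
  refine Finset.sum_bij_ne_zero (fun x _ _ => x.2) ?_ ?_ ?_ ?_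
  · rintro ⟨n, i, j⟩ h1 _
    simp only [Finset.mem_sigma, Finset.mem_range, Finset.HasAntidiagonal.mem_antidiagonal] at h1
    simp only [Finset.mem_product, Finset.mem_range]
    omega
  · rintro ⟨n, i, j⟩ h1 _ ⟨n', i', j'⟩ h2 _ h
    simp only [Finset.mem_sigma, Finset.mem_range, Finset.HasAntidiagonal.mem_antidiagonal] at h1 h2
    simp only [Prod.mk.injEq] at h
    obtain ⟨rfl, rfl⟩ := h
    obtain rfl : n = n' := by omega
    rfl
  · rintro ⟨i, j⟩ h1 h2
    have hij : i + j < N := by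
      by_contra hcon
      exact h2 (by rw [hz _ (not_lt.mp hcon), smul_zero])
    exact ⟨⟨i + j, i, j⟩, by simp [hij], by simpa using h2, rfl⟩
  · rintro ⟨n, i, j⟩ h1 _
    simp only [Finset.mem_sigma, Finset.mem_range, Finset.HasAntidiagonal.mem_antidiagonal] at h1
    rw [← h1.2]

theorem diffOp_comm (g h : PowerSeries k) (f : k[X]) :
    diffOp g (diffOp h f) = diffOp h (diffOp g f) := by
  rw [← diffOp_mul_left, mul_comm, diffOp_mul_left]

/-- The Pincherle derivative `[g(D), x] = g'(D)`, by linearity from `D^i x = x D^i + i D^{i-1}`. -/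
theorem diffOp_X_mul (g : PowerSeries k) (f : k[X]) :
    diffOp g (X * f) = X * diffOp g f + diffOp (PowerSeries.derivative k g) f := by
  have h : (X * f).natDegree < f.natDegree + 2 := by
    have := natDegree_mul_le (p := (X : k[X])) (q := f)
    have := natDegree_X_le (R := k)
    omega
  rw [diffOp_eq_sum g h, diffOp_eq_sum g (show f.natDegree < f.natDegree + 2 by omega), diffOp]
  have key : ∀ i, derivative^[i] (X * f) =
      X * derivative^[i] f + i • derivative^[i - 1] f := fun i => by
    rw [mul_comm, iterate_derivative_mul_X, mul_comm]
  simp only [key, smul_add, Finset.sum_add_distrib, Finset.mul_sum,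
    mul_smul_comm]
  congr 1
  rw [Finset.sum_range_succ']
  simp [PowerSeries.coeff_derivative, mul_smul, ← Nat.cast_smul_eq_nsmul k]

theorem coeff_diffOp (g : PowerSeries k) (f : k[X]) (m : ℕ) :
    (diffOp g f).coeff m = ∑ i ∈ Finset.range (f.natDegree + 1),
      PowerSeries.coeff i g * ((m + i).descFactorial i * f.coeff (m + i)) := by
  simp [diffOp, finsetSum_coeff, coeff_iterate_derivative]

theorem diffOp_one (g : PowerSeries k) : diffOp g 1 = C (PowerSeries.coeff 0 g) := by
  simp [diffOp, smul_eq_C_mul]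

theorem map_diffOp {R : Type*} [CommRing R] (φ : k →+* R) (g : PowerSeries k) (f : k[X]) :
    (diffOp g f).map φ = diffOp (PowerSeries.map φ g) (f.map φ) := by
  rw [diffOp_eq_sum _ (Nat.lt_succ_of_le (natDegree_map_le (p := f) (f := φ))), diffOp,
    Polynomial.map_sum]
  simp [smul_eq_C_mul, iterate_derivative_map]

/-- The top coefficient is multiplied by `g(0)`. -/
theorem coeff_diffOp_of_natDegree_le (g : PowerSeries k) {f : k[X]} {n : ℕ}
    (h : f.natDegree ≤ n) : (diffOp g f).coeff n = PowerSeries.coeff 0 g * f.coeff n := by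
  rw [coeff_diffOp, Finset.sum_eq_single 0]
  · simp
  · intro i _ hi
    rw [coeff_eq_zero_of_natDegree_lt (by omega), mul_zero, mul_zero]
  · simp

theorem IsGradedSeq.diffOp {p : ℕ → k[X]} (hp : IsGradedSeq p) {g : PowerSeries k}
    (hg : PowerSeries.coeff 0 g = 1) : IsGradedSeq fun n => diffOp g (p n) := by
  intro n
  obtain ⟨hd, hu⟩ := hp n
  have hnd : (p n).natDegree = n := natDegree_eq_of_degree_eq_some hd
  have hc : (Umbral.diffOp g (p n)).coeff n = (p n).leadingCoeff := by
    rw [coeff_diffOp_of_natDegree_le g hnd.le, hg, one_mul, leadingCoeff, hnd]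
  have hne : (p n).leadingCoeff ≠ 0 := by
    rw [Ne, leadingCoeff_eq_zero]
    rintro h0
    simp [h0] at hd
  have hnd' : (Umbral.diffOp g (p n)).natDegree = n :=
    le_antisymm ((natDegree_diffOp_le g _).trans hnd.le)
      (le_natDegree_of_ne_zero (by rwa [hc]))
  refine ⟨?_, by rwa [leadingCoeff, hnd', hc]⟩
  change (Umbral.diffOp g (p n)).degree = n
  rw [degree_eq_natDegree, hnd']
  rintro h0
  rw [h0, coeff_zero] at hc
  exact hne hc.symm

variable [Algebra ℚ k]

theorem isUnit_natCast {n : ℕ} (hn : n ≠ 0) : IsUnit (n : k) := by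
  have : IsUnit (algebraMap ℚ k n) :=
    (IsUnit.mk0 (n : ℚ) (Nat.cast_ne_zero.mpr hn)).map (algebraMap ℚ k)
  simpa using this

/-- The kernel of a delta operator consists of the constants. -/
theorem IsDelta.eq_C_of_diffOp_eq_zero {g : PowerSeries k} (hg : IsDelta g) {f : k[X]}
    (hf : diffOp g f = 0) : f = C (f.coeff 0) := by
  refine eq_C_of_natDegree_eq_zero ?_
  by_contra hn
  obtain ⟨m, hm⟩ := Nat.exists_eq_succ_of_ne_zero hn
  -- One below the degree only `i = 1` survives: `i = 0` dies by `g(0) = 0`, and larger `i` reach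
  -- past the degree of `f`.
  have h : (diffOp g f).coeff m = PowerSeries.coeff 1 g * ((m + 1 : ℕ) * f.coeff (m + 1)) := by
    rw [coeff_diffOp, Finset.sum_eq_single 1]
    · simp
    · intro i _ hi
      rcases Nat.eq_zero_or_pos i with rfl | hpos
      · rw [hg.1, zero_mul]
      · rw [coeff_eq_zero_of_natDegree_lt (by omega), mul_zero, mul_zero]
    · intro h
      exact absurd (Finset.mem_range.mpr (by omega)) h
  rw [hf, coeff_zero, eq_comm, hg.2.mul_right_eq_zero,
    (isUnit_natCast m.succ_ne_zero).mul_right_eq_zero, ← Nat.succ_eq_add_one, ← hm,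
    coeff_natDegree, leadingCoeff_eq_zero] at h
  exact hn (by rw [h, natDegree_zero])

/-- A sequence with `g(D) r_n = n r_{n-1}` is determined by the values `r_n(0)`. -/
theorem IsDelta.seq_unique {g : PowerSeries k} (hg : IsDelta g) {r t : ℕ → k[X]}
    (hr : ∀ n, diffOp g (r n) = n • r (n - 1)) (ht : ∀ n, diffOp g (t n) = n • t (n - 1))
    (h0 : ∀ n, (r n).coeff 0 = (t n).coeff 0) (n : ℕ) : r n = t n := by
  have step : ∀ n, n • r (n - 1) = n • t (n - 1) → r n = t n := fun n h => by
    have := hg.eq_C_of_diffOp_eq_zero (f := r n - t n)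
      (by rw [diffOp_sub, hr, ht, h, sub_self])
    rwa [coeff_sub, h0, sub_self, C_0, sub_eq_zero] at this
  induction n with
  | zero => exact step 0 (by simp)
  | succ n ih => exact step _ (by rw [Nat.add_sub_cancel, ih])

/-- The exponential generating function of a sequence. -/
def egf (m : ℕ → k) : PowerSeries k := PowerSeries.mk fun n => (1 / (n.factorial : ℚ)) • m n

theorem egf_factorial_smul_coeff (g : PowerSeries k) :
    egf (fun n => (n.factorial : ℚ) • PowerSeries.coeff n g) = g := by
  ext n
  rw [egf, PowerSeries.coeff_mk, smul_smul, one_div_mul_cancel, one_smul]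
  exact_mod_cast n.factorial_ne_zero

theorem coeff_zero_egf (m : ℕ → k) : PowerSeries.coeff 0 (egf m) = m 0 := by
  simp [egf]

theorem egf_injective : Function.Injective (egf (k := k)) := by
  intro m m' h
  funext n
  have := congrArg (fun g => (n.factorial : ℚ) • PowerSeries.coeff n g) h
  have hn : (n.factorial : ℚ) ≠ 0 := by exact_mod_cast n.factorial_ne_zero
  simpa [egf, smul_smul, hn] using this

theorem map_egf {R : Type*} [CommRing R] [Algebra ℚ R] (φ : k →+* R) (m : ℕ → k) :
    PowerSeries.map φ (egf m) = egf fun n => φ (m n) := by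
  ext n
  simp only [egf, PowerSeries.coeff_map, PowerSeries.coeff_mk]
  exact map_rat_smul φ _ _

/-- The `1/i!` of the generating function turns the falling factorial from `D^i` into a binomial
coefficient, so the result is `(x + a)^n` expanded with `m i` in place of `a^i`. -/
theorem diffOp_egf_X_pow (m : ℕ → k) (n : ℕ) :
    diffOp (egf m) (X ^ n) =
      ∑ i ∈ Finset.range (n + 1), C (m i * (n.choose i : k)) * X ^ (n - i) := by
  rw [diffOp_eq_sum _ (Nat.lt_succ_of_le (natDegree_X_pow_le n))]
  refine Finset.sum_congr rfl fun i _ => ?_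
  have hi : (i.factorial : ℚ) ≠ 0 := by exact_mod_cast i.factorial_ne_zero
  rw [iterate_derivative_X_pow_eq_smul, smul_smul, smul_eq_C_mul, egf, PowerSeries.coeff_mk,
    Nat.descFactorial_eq_factorial_mul_choose, smul_mul_assoc, ← mul_smul_comm]
  congr 3
  rw [Nat.cast_mul, ← smul_mul_assoc]
  suffices h : (1 / (i.factorial : ℚ)) • (i.factorial : k) = 1 by rw [h, one_mul]
  rw [Algebra.smul_def, ← map_natCast (algebraMap ℚ k), ← map_mul, one_div_mul_cancel hi, map_one]

end Operators

/-! ### The series `e^{x f(z)}`, logarithms and powers -/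

section GeneratingFunctions

variable {k : Type*} [CommRing k]

theorem coeff_pow_eq_zero_of_lt {f : PowerSeries k} (hf : PowerSeries.constantCoeff f = 0)
    {n d : ℕ} (h : n < d) : PowerSeries.coeff n (f ^ d) = 0 :=
  PowerSeries.X_pow_dvd_iff.mp (pow_dvd_pow_of_dvd (PowerSeries.X_dvd_iff.mpr hf) d) n h

theorem coeff_subst_eq_sum {R : Type*} [CommRing R] [Algebra k R] {f : PowerSeries R}
    (hf : PowerSeries.constantCoeff f = 0) (g : PowerSeries k) {n N : ℕ} (h : n < N) :
    PowerSeries.coeff n (g.subst f) =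
      ∑ d ∈ Finset.range N, PowerSeries.coeff d g • PowerSeries.coeff n (f ^ d) := by
  rw [PowerSeries.coeff_subst' (PowerSeries.HasSubst.of_constantCoeff_zero' hf)]
  refine finsum_eq_sum_of_support_subset _ fun d hd => ?_
  rw [Finset.coe_range, Set.mem_Iio]
  by_contra hcon
  exact hd (by simp only [coeff_pow_eq_zero_of_lt hf (show n < d by omega), smul_zero])

theorem coeff_zero_subst {f : PowerSeries k} (hf : PowerSeries.constantCoeff f = 0)
    (g : PowerSeries k) : PowerSeries.coeff 0 (g.subst f) = PowerSeries.coeff 0 g := by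
  rw [coeff_subst_eq_sum hf g Nat.zero_lt_one]
  simp

theorem constantCoeff_map {R : Type*} [CommRing R] (φ : k →+* R) (g : PowerSeries k) :
    PowerSeries.constantCoeff (PowerSeries.map φ g) = φ (PowerSeries.constantCoeff g) := by
  rw [← PowerSeries.coeff_zero_eq_constantCoeff_apply, PowerSeries.coeff_map,
    PowerSeries.coeff_zero_eq_constantCoeff_apply]

/-- The operators `D` and multiplication by `f(z)` have the same effect on `P(x, z)`. -/
def DerivEqMul (f : PowerSeries k) (P : PowerSeries k[X]) : Prop :=
  ∀ n, derivative (PowerSeries.coeff n P) =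
    PowerSeries.coeff n (PowerSeries.map C f * P)

variable {f : PowerSeries k} {P : PowerSeries k[X]}

theorem DerivEqMul.map_C_mul (h : DerivEqMul f P) (g : PowerSeries k) :
    DerivEqMul f (PowerSeries.map C g * P) := by
  intro n
  rw [mul_left_comm, PowerSeries.coeff_mul, PowerSeries.coeff_mul, derivative_sum]
  refine Finset.sum_congr rfl fun x _ => ?_
  rw [PowerSeries.coeff_map, derivative_C_mul, h]

theorem DerivEqMul.iterate (h : DerivEqMul f P) (d n : ℕ) :
    derivative^[d] (PowerSeries.coeff n P) =
      PowerSeries.coeff n (PowerSeries.map C (f ^ d) * P) := by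
  induction d with
  | zero => simp
  | succ d ih =>
    rw [Function.iterate_succ_apply', ih, h.map_C_mul, ← mul_assoc, ← map_mul, pow_succ']

/-- If `D` acts on `P(x, z)` as multiplication by `f(z)`, then `g(D)` acts as multiplication
by `g(f(z))`. -/
theorem DerivEqMul.diffOp (h : DerivEqMul f P) (hf : PowerSeries.constantCoeff f = 0)
    (g : PowerSeries k) (n : ℕ) :
    diffOp g (PowerSeries.coeff n P) =
      PowerSeries.coeff n (PowerSeries.map C (g.subst f) * P) := by
  -- One cutoff serves both for `g(D)` on this coefficient and for the coefficients of `g(f(z))` up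
  -- to `n`.
  set N := max (PowerSeries.coeff n P).natDegree n + 1 with hN
  rw [diffOp_eq_sum g (show (PowerSeries.coeff n P).natDegree < N by omega),
    PowerSeries.coeff_mul]
  simp only [h.iterate, PowerSeries.coeff_mul, Finset.smul_sum]
  rw [Finset.sum_comm]
  refine Finset.sum_congr rfl fun x hx => ?_
  have hx' : x.1 < N := by
    have := Finset.HasAntidiagonal.mem_antidiagonal.mp hx
    omega
  rw [PowerSeries.coeff_map, coeff_subst_eq_sum hf g hx', map_sum, Finset.sum_mul]
  refine Finset.sum_congr rfl fun d _ => ?_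
  rw [PowerSeries.coeff_map, smul_eq_mul, C_mul, mul_assoc, smul_eq_C_mul]

theorem constantCoeff_C_mul_map (hf : PowerSeries.constantCoeff f = 0) :
    PowerSeries.constantCoeff (PowerSeries.C (X : k[X]) * PowerSeries.map C f) = 0 := by
  rw [map_mul, constantCoeff_map, hf, map_zero, mul_zero]

variable [Algebra ℚ k]

theorem isAddTorsionFree_of_algebra_rat (R : Type*) [CommRing R] [Algebra ℚ R] :
    IsAddTorsionFree R := by
  refine ⟨fun n hn x y h => ?_⟩
  have h' : (n : R) * x = n * y := by simpa [nsmul_eq_mul] using h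
  exact (isUnit_natCast hn).mul_left_cancel h'

/-- The solution `P(x, z)` of `D P = f(z) P` is determined by `P(0, z)`. -/
theorem DerivEqMul.unique {P' : PowerSeries k[X]} (h : DerivEqMul f P) (h' : DerivEqMul f P')
    (hf : PowerSeries.constantCoeff f = 0)
    (h0 : ∀ n, (PowerSeries.coeff n P).coeff 0 = (PowerSeries.coeff n P').coeff 0) : P = P' := by
  ext1 n
  induction n using Nat.strong_induction_on with
  | _ n ih =>
    have hd : derivative (PowerSeries.coeff n P - PowerSeries.coeff n P') = 0 := by
      rw [derivative_sub, h, h', PowerSeries.coeff_mul, PowerSeries.coeff_mul,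
        ← Finset.sum_sub_distrib]
      refine Finset.sum_eq_zero fun x hx => ?_
      have hx := Finset.HasAntidiagonal.mem_antidiagonal.mp hx
      -- Since `f(0) = 0`, the term containing the `n`th coefficients themselves vanishes; only
      -- earlier ones remain.
      rcases Nat.eq_zero_or_pos x.1 with h1 | h1
      · simp [h1, hf]
      · rw [ih x.2 (by omega), sub_self]
    have := isAddTorsionFree_of_algebra_rat k
    have := eq_C_of_derivative_eq_zero hd
    rwa [coeff_sub, h0, sub_self, C_0, sub_eq_zero] at this

/-- The series `e ^ (x f(z))`. -/
def expMul (f : PowerSeries k) : PowerSeries k[X] :=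
  (PowerSeries.exp k[X]).subst (PowerSeries.C (X : k[X]) * PowerSeries.map C f)

theorem coeff_expMul (hf : PowerSeries.constantCoeff f = 0) {n N : ℕ} (h : n < N) :
    PowerSeries.coeff n (expMul f) = ∑ d ∈ Finset.range N,
      C (algebraMap ℚ k (1 / d.factorial) * PowerSeries.coeff n (f ^ d)) * X ^ d := by
  rw [expMul, coeff_subst_eq_sum (constantCoeff_C_mul_map hf) _ h]
  refine Finset.sum_congr rfl fun d _ => ?_
  rw [mul_pow, ← map_pow, ← map_pow, PowerSeries.coeff_C_mul, PowerSeries.coeff_map,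
    PowerSeries.coeff_exp, smul_eq_mul, C_mul, IsScalarTower.algebraMap_apply ℚ k k[X],
    algebraMap_eq]
  ring

theorem coeff_zero_coeff_expMul (hf : PowerSeries.constantCoeff f = 0) (n : ℕ) :
    (PowerSeries.coeff n (expMul f)).coeff 0 = if n = 0 then 1 else 0 := by
  rw [coeff_expMul hf n.lt_succ_self, finsetSum_coeff, Finset.sum_eq_single 0]
  · split_ifs with h <;> simp [PowerSeries.coeff_one, h]
  · intro d _ hd
    rw [coeff_C_mul, coeff_X_pow, if_neg hd.symm, mul_zero]
  · simp

theorem derivEqMul_expMul (hf : PowerSeries.constantCoeff f = 0) : DerivEqMul f (expMul f) := by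
  intro n
  have key : ∀ x ∈ Finset.HasAntidiagonal.antidiagonal n,
      PowerSeries.coeff x.1 (PowerSeries.map C f) * PowerSeries.coeff x.2 (expMul f) =
      ∑ d ∈ Finset.range (n + 1), C (algebraMap ℚ k (1 / d.factorial)) *
        C (PowerSeries.coeff x.1 f * PowerSeries.coeff x.2 (f ^ d)) * X ^ d := by
    intro x hx
    have hx := Finset.HasAntidiagonal.mem_antidiagonal.mp hx
    rw [coeff_expMul hf (show x.2 < n + 1 by omega), Finset.mul_sum]
    refine Finset.sum_congr rfl fun d _ => ?_
    rw [PowerSeries.coeff_map, C_mul, C_mul]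
    ring
  -- The left side is truncated one term later: the term `d = 0` is killed by `D`, and term `d + 1`
  -- matches term `d` on the right.
  rw [PowerSeries.coeff_mul, Finset.sum_congr rfl key, Finset.sum_comm,
    coeff_expMul hf (show n < n + 1 + 1 by omega), Finset.sum_range_succ', derivative_add,
    derivative_sum]
  simp only [pow_zero, mul_one, derivative_C, add_zero]
  refine Finset.sum_congr rfl fun d _ => ?_
  rw [← Finset.sum_mul, ← Finset.mul_sum, ← map_sum, ← PowerSeries.coeff_mul, ← pow_succ',
    derivative_C_mul, derivative_X_pow, Nat.add_sub_cancel, ← mul_assoc, ← C_mul, ← C_mul]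
  congr 2
  have hd : algebraMap ℚ k (1 / d.factorial) =
      algebraMap ℚ k (1 / (d + 1).factorial) * ((d + 1 : ℕ) : k) := by
    rw [← map_natCast (algebraMap ℚ k), ← map_mul, Nat.factorial_succ]
    congr 1
    have : (d.factorial : ℚ) ≠ 0 := by exact_mod_cast d.factorial_ne_zero
    push_cast
    field_simp
  rw [hd]
  ring

theorem map_logOf {R : Type*} [CommRing R] [Algebra ℚ R] (φ : k →+* R) {g : PowerSeries k}
    (hg : PowerSeries.constantCoeff g = 1) :
    PowerSeries.map φ (PowerSeries.logOf g) = PowerSeries.logOf (PowerSeries.map φ g) := by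
  have h := PowerSeries.map_subst (h := φ) (PowerSeries.HasSubst.of_constantCoeff_zero'
    (show PowerSeries.constantCoeff (g - 1) = 0 by simp [hg])) (PowerSeries.log k)
  rw [PowerSeries.map_log] at h
  rw [PowerSeries.logOf_eq, PowerSeries.logOf_eq]
  refine h.trans ?_
  congr 1
  exact (map_sub (PowerSeries.map φ) g 1).trans (by rw [map_one])

theorem map_expMul {R : Type*} [CommRing R] [Algebra ℚ R] (φ : k →+* R)
    (hf : PowerSeries.constantCoeff f = 0) :
    PowerSeries.map (mapRingHom φ) (expMul f) = expMul (PowerSeries.map φ f) := by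
  ext1 n
  have hf' : PowerSeries.constantCoeff (PowerSeries.map φ f) = 0 := by
    rw [constantCoeff_map, hf, map_zero]
  rw [PowerSeries.coeff_map, coeff_expMul hf n.lt_succ_self, coeff_expMul hf' n.lt_succ_self,
    map_sum]
  refine Finset.sum_congr rfl fun d _ => ?_
  rw [← map_pow, PowerSeries.coeff_map]
  simp only [coe_mapRingHom, Polynomial.map_pow, map_C, map_X, map_mul,
    RingHom.map_rat_algebraMap]

theorem dotPoly_eq (g : PowerSeries k) (n : ℕ) :
    dotPoly g n = (n.factorial : ℚ) • PowerSeries.coeff n (expMul (PowerSeries.logOf g)) := rfl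

theorem egf_dotPoly (g : PowerSeries k) : egf (dotPoly g) = expMul (PowerSeries.logOf g) :=
  egf_factorial_smul_coeff _

theorem map_dotPoly {R : Type*} [CommRing R] [Algebra ℚ R] (φ : k →+* R) {g : PowerSeries k}
    (hg : PowerSeries.constantCoeff g = 1) (n : ℕ) :
    (dotPoly g n).map φ = dotPoly (PowerSeries.map φ g) n := by
  rw [dotPoly_eq, dotPoly_eq, ← map_logOf φ hg,
    ← map_expMul φ (PowerSeries.constantCoeff_logOf hg), PowerSeries.coeff_map]
  exact map_rat_smul (mapRingHom φ) _ _

/-- The chain rule reduces this to `log'(1 + t) (1 + t) = 1`, a geometric series, with `g - 1`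
substituted for `t`. -/
theorem derivative_logOf_mul {g : PowerSeries k} (hg : PowerSeries.constantCoeff g = 1) :
    PowerSeries.derivative k (PowerSeries.logOf g) * g = PowerSeries.derivative k g := by
  have hs : PowerSeries.HasSubst (g - 1) := PowerSeries.HasSubst.of_constantCoeff_zero'
    (show PowerSeries.constantCoeff (g - 1) = 0 by simp [hg])
  have h1 : PowerSeries.derivative k (PowerSeries.log k) * (1 + PowerSeries.X) = 1 := by
    rw [PowerSeries.deriv_log]
    ext n
    rw [mul_add, mul_one, map_add]
    cases n with
    | zero => simp
    | succ n =>
      rw [PowerSeries.coeff_succ_mul_X, PowerSeries.coeff_mk, PowerSeries.coeff_mk, ← map_add,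
        PowerSeries.coeff_one, if_neg n.succ_ne_zero, pow_succ]
      simp
  have h2 : (PowerSeries.derivative k (PowerSeries.log k)).subst (g - 1) * g = 1 := by
    have := congrArg (PowerSeries.subst (g - 1)) h1
    rw [PowerSeries.subst_mul hs, PowerSeries.subst_add hs, PowerSeries.subst_X hs,
      ← PowerSeries.coe_substAlgHom hs, map_one, add_sub_cancel,
      PowerSeries.coe_substAlgHom hs] at this
    exact this
  rw [PowerSeries.logOf_eq, PowerSeries.derivative_subst hs, map_sub, PowerSeries.derivative_one,
    sub_zero, mul_right_comm, h2, one_mul]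

theorem constantCoeff_exp_subst (hf : PowerSeries.constantCoeff f = 0) :
    PowerSeries.constantCoeff ((PowerSeries.exp k).subst f) = 1 := by
  rw [← PowerSeries.coeff_zero_eq_constantCoeff_apply, coeff_zero_subst hf]
  simp

/-- Both sides have constant term `0`, and their derivatives agree after multiplication by the unit
`e^f`. -/
theorem logOf_exp_subst (hf : PowerSeries.constantCoeff f = 0) :
    PowerSeries.logOf ((PowerSeries.exp k).subst f) = f := by
  have := isAddTorsionFree_of_algebra_rat k
  have hg := constantCoeff_exp_subst hf
  refine PowerSeries.derivative.ext ?_ (by rw [PowerSeries.constantCoeff_logOf hg, hf])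
  have hu : IsUnit ((PowerSeries.exp k).subst f : PowerSeries k) := by
    rw [PowerSeries.isUnit_iff_constantCoeff, hg]
    exact isUnit_one
  refine hu.mul_right_cancel ?_
  rw [derivative_logOf_mul hg,
    PowerSeries.derivative_subst (PowerSeries.HasSubst.of_constantCoeff_zero' hf),
    PowerSeries.derivative_exp, mul_comm]

/-- The equation expresses `(n + 1) G_{n+1}` through `G_0, …, G_n`, and `n + 1` is invertible. -/
theorem derivative_eq_mul_unique {K G H : PowerSeries k}
    (hG : PowerSeries.derivative k G = K * G) (hH : PowerSeries.derivative k H = K * H)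
    (h0 : PowerSeries.constantCoeff G = PowerSeries.constantCoeff H) : G = H := by
  ext n
  induction n using Nat.strong_induction_on with
  | _ n ih =>
    rcases n with _ | n
    · simpa using h0
    have h1 := congrArg (PowerSeries.coeff n) hG
    have h2 := congrArg (PowerSeries.coeff n) hH
    rw [PowerSeries.coeff_derivative, PowerSeries.coeff_mul] at h1 h2
    have h3 : PowerSeries.coeff (n + 1) G * ((n + 1 : ℕ) : k) =
        PowerSeries.coeff (n + 1) H * ((n + 1 : ℕ) : k) := by
      push_cast
      rw [h1, h2]
      refine Finset.sum_congr rfl fun x hx => ?_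
      have hx := Finset.HasAntidiagonal.mem_antidiagonal.mp hx
      rw [ih x.2 (by omega)]
    exact (isUnit_natCast n.succ_ne_zero).mul_right_cancel h3

/-- Substituting a natural number for `x` in `e ^ (x log g)` gives a power of `g`. -/
theorem map_eval_natCast_expMul {g : PowerSeries k} (hg : PowerSeries.constantCoeff g = 1)
    (n : ℕ) : PowerSeries.map (evalRingHom (n : k)) (expMul (PowerSeries.logOf g)) = g ^ n := by
  have hl := PowerSeries.constantCoeff_logOf hg
  have hs := PowerSeries.HasSubst.of_constantCoeff_zero' (constantCoeff_C_mul_map hl)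
  have hm : PowerSeries.map (evalRingHom (n : k))
      (PowerSeries.C (X : k[X]) * PowerSeries.map C (PowerSeries.logOf g)) =
      n • PowerSeries.logOf g := by
    ext i
    rw [PowerSeries.coeff_map, PowerSeries.coeff_C_mul, PowerSeries.coeff_map, map_mul, map_nsmul,
      nsmul_eq_mul]
    simp
  have hl' : PowerSeries.constantCoeff (n • PowerSeries.logOf g) = 0 := by simp [hl]
  have h1 : PowerSeries.map (evalRingHom (n : k)) (expMul (PowerSeries.logOf g)) =
      (PowerSeries.exp k).subst (n • PowerSeries.logOf g) := by
    rw [← hm, ← PowerSeries.map_exp (f := evalRingHom (n : k))]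
    exact PowerSeries.map_subst hs _
  rw [h1]
  -- Both `e^{n log g}` and `g^n` solve `G' = n (log g)' G` with constant term `1`.
  refine derivative_eq_mul_unique (K := n • PowerSeries.derivative k (PowerSeries.logOf g)) ?_ ?_ ?_
  · rw [PowerSeries.derivative_subst (PowerSeries.HasSubst.of_constantCoeff_zero' hl'),
      PowerSeries.derivative_exp, mul_comm, map_nsmul]
  · rw [PowerSeries.derivative_pow, ← derivative_logOf_mul hg, nsmul_eq_mul]
    rcases n with _ | n
    · simp
    · rw [Nat.add_sub_cancel]
      ring
  · rw [constantCoeff_exp_subst hl', map_pow, hg, one_pow]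

theorem egf_eval_natCast_dotPoly {g : PowerSeries k} (hg : PowerSeries.constantCoeff g = 1)
    (n : ℕ) : egf (fun j => (dotPoly g j).eval (n : k)) = g ^ n := by
  rw [← map_eval_natCast_expMul hg, ← egf_dotPoly, map_egf]
  rfl

end GeneratingFunctions

/-! ### Structure of binomial-type and Sheffer sequences -/

section BinomialType

variable {k : Type*} [CommRing k] {p s : ℕ → k[X]}

theorem IsBinomialType.aeval_add {A : Type*} [CommRing A] [Algebra k A] (hp : IsBinomialType p)
    (a b : A) (n : ℕ) : aeval (a + b) (p n) = ∑ i ∈ Finset.range (n + 1),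
      (n.choose i : A) * (aeval a (p i) * aeval b (p (n - i))) := by
  have key : ∀ (u : MvPolynomial (Fin 2) k) (q : k[X]),
      MvPolynomial.aeval ![a, b] (aeval u q) = aeval (MvPolynomial.aeval ![a, b] u) q :=
    fun u q => (aeval_algHom_apply (MvPolynomial.aeval ![a, b]) u q).symm
  have h := congrArg (MvPolynomial.aeval ![a, b]) (hp.2 n)
  simpa only [map_sum, map_mul, map_natCast, key, map_add, MvPolynomial.aeval_X,
    Matrix.cons_val_zero, Matrix.cons_val_one] using h

theorem IsGradedSeq.natDegree (hp : IsGradedSeq p) (n : ℕ) : (p n).natDegree = n :=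
  natDegree_eq_of_degree_eq_some (hp n).1

theorem IsGradedSeq.isUnit_coeff (hp : IsGradedSeq p) (n : ℕ) : IsUnit ((p n).coeff n) := by
  have := (hp n).2
  rwa [leadingCoeff, hp.natDegree] at this

/-- The coefficient form of `D p_n = ∑ (n choose i) p_i p_{n-i}'(0)`. -/
theorem IsBinomialType.derivative (hp : IsBinomialType p) (n : ℕ) :
    derivative (p n) = ∑ i ∈ Finset.range (n + 1),
      (n.choose i : k[X]) * (p i * C ((p (n - i)).coeff 1)) := by
  -- In `k[x][y]` the coefficient of `y` in `p_n(x + y)` is `p_n'(x)`, by Taylor expansion.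
  have h := congrArg (fun q : k[X][X] => q.coeff 1)
    (hp.aeval_add (C X : k[X][X]) (X : k[X][X]) n)
  have h1 : ∀ q : k[X], aeval (C X : k[X][X]) q = C q := fun q => by
    rw [← algebraMap_eq, aeval_algebraMap_apply, aeval_X_left_apply]
  have h2 : ∀ (u : k[X][X]) (q : k[X]), aeval u q = (q.map C).comp u := fun u q => by
    rw [aeval_def, IsScalarTower.algebraMap_eq k k[X] k[X][X], ← eval₂_map]
    rfl
  have h3 : ∀ q : k[X], (aeval (C X + X : k[X][X]) q).coeff 1 = Polynomial.derivative q :=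
    fun q => by
      rw [h2, add_comm, ← taylor_apply, taylor_coeff_one, derivative_map, eval_map, eval₂_C_X]
  rw [h3, finsetSum_coeff] at h
  rw [h]
  refine Finset.sum_congr rfl fun i _ => ?_
  rw [h1, h2, comp_X, ← C_eq_natCast, coeff_C_mul, coeff_C_mul, coeff_map]

/-- The polynomials `x (x + n . α) ^ (n - 1)` after evaluation of `α`, where `g(z) ≃ e ^ (αz)`. -/
def abelPoly (g : PowerSeries k) : ℕ → k[X]
  | 0 => 1
  | n + 1 => X * diffOp (g ^ (n + 1)) (X ^ n)

/-- The polynomials `x (x + μ₁) ⋯ (x + μ₁ + ⋯ + μₙ₋₁)` after evaluation of the `μᵢ`, where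
`g(z) ≃ e ^ (μᵢ z)`. -/
def risingPoly (g : PowerSeries k) : ℕ → k[X]
  | 0 => 1
  | n + 1 => X * diffOp g (risingPoly g n)

theorem coeff_zero_abelPoly (g : PowerSeries k) (n : ℕ) :
    (abelPoly g n).coeff 0 = if n = 0 then 1 else 0 := by
  cases n <;> simp [abelPoly]

theorem IsDelta.coeff_one_eq {φ : PowerSeries k} (hφ : IsDelta φ) (hX : diffOp φ X = 1) :
    PowerSeries.coeff 1 φ = 1 := by
  have h := diffOp_X_mul φ 1
  rw [mul_one, hX, diffOp_one, diffOp_one, hφ.1, C_0, mul_zero, zero_add,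
    PowerSeries.coeff_derivative, ← C_1, C_inj] at h
  simpa using h.symm

/-- With `φ = tψ`, moving `φ(D)` past `x` in `x U^{n+1} x^n` gives `x U^n D x^n + φ' U^{n+1} x^n`,
and `φ' U^{n+1} = U^n + ψ' U^{n+1} t`. Moving `U^n` past one `x` of `x^n` produces `(U^n)' = -n ψ'
U^{n+1}`, which cancels the `ψ'` term and leaves `(n + 1) x U^n x^{n-1}`. -/
theorem diffOp_abelPoly {ψ U : PowerSeries k} (hU : ψ * U = 1) (n : ℕ) :
    diffOp (PowerSeries.X * ψ) (abelPoly U n) = n • abelPoly U (n - 1) := by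
  rcases n with _ | n
  · simp [abelPoly, diffOp_one]
  have hder : PowerSeries.derivative k (PowerSeries.X * ψ) =
      ψ + PowerSeries.X * PowerSeries.derivative k ψ := by
    rw [Derivation.leibniz, PowerSeries.derivative_X]
    simp only [smul_eq_mul]
    ring
  have hU' : PowerSeries.derivative k U = - (U ^ 2 * PowerSeries.derivative k ψ) := by
    have h := congrArg (PowerSeries.derivative k) hU
    rw [Derivation.leibniz, PowerSeries.derivative_one] at h
    simp only [smul_eq_mul] at h
    linear_combination U * h - PowerSeries.derivative k U * hU
  have h1 : PowerSeries.X * ψ * U ^ (n + 1) = U ^ n * PowerSeries.X := by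
    rw [pow_succ]
    linear_combination PowerSeries.X * U ^ n * hU
  have h2 : (ψ + PowerSeries.X * PowerSeries.derivative k ψ) * U ^ (n + 1) =
      U ^ n + PowerSeries.derivative k ψ * U ^ (n + 1) * PowerSeries.X := by
    rw [pow_succ]
    linear_combination U ^ n * hU
  rw [abelPoly, diffOp_X_mul, hder, ← diffOp_mul_left, ← diffOp_mul_left, h1, h2,
    diffOp_add_left, diffOp_mul_left, diffOp_mul_left _ PowerSeries.X, diffOp_X_left,
    Nat.add_sub_cancel]
  rcases n with _ | m
  · simp [abelPoly, diffOp_zero, diffOp_one_left]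
  · have h3 : PowerSeries.derivative k (U ^ (m + 1)) =
        - ((m + 1) • (PowerSeries.derivative k ψ * U ^ (m + 1 + 1))) := by
      rw [PowerSeries.derivative_pow, hU', Nat.add_sub_cancel, nsmul_eq_mul]
      ring
    have h4 : ∀ (g : PowerSeries k) (q : k[X]), diffOp (-g) q = - diffOp g q := fun g q => by
      simp [diffOp]
    have h5 : diffOp (U ^ (m + 1)) (X ^ (m + 1) : k[X]) = X * diffOp (U ^ (m + 1)) (X ^ m) -
        (m + 1) • diffOp (PowerSeries.derivative k ψ * U ^ (m + 1 + 1)) (X ^ m) := by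
      rw [pow_succ' X, diffOp_X_mul, h3, h4, diffOp_nsmul_left, sub_eq_add_neg]
    have h6 : Polynomial.derivative (X ^ (m + 1) : k[X]) = (m + 1) • X ^ m := by
      rw [derivative_X_pow, Nat.add_sub_cancel, nsmul_eq_mul]
      simp
    rw [h6, diffOp_nsmul, diffOp_nsmul, h5, abelPoly]
    simp only [nsmul_eq_mul]
    push_cast
    ring

variable [Algebra ℚ k]

theorem coeff_egf (m : ℕ → k) (n : ℕ) :
    PowerSeries.coeff n (egf m) = (1 / (n.factorial : ℚ)) • m n := PowerSeries.coeff_mk _ _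

theorem egf_mul (u v : ℕ → k) : egf u * egf v =
    egf fun n => ∑ i ∈ Finset.range (n + 1), (n.choose i : k) * (u i * v (n - i)) := by
  ext n
  rw [PowerSeries.coeff_mul, coeff_egf, Finset.smul_sum,
    Finset.Nat.sum_antidiagonal_eq_sum_range_succ_mk]
  refine Finset.sum_congr rfl fun i hi => ?_
  have hi : i ≤ n := Nat.lt_succ_iff.mp (Finset.mem_range.mp hi)
  have h : (1 / (i.factorial : ℚ)) * (1 / ((n - i).factorial : ℚ)) =
      (1 / (n.factorial : ℚ)) * (n.choose i : ℚ) := by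
    rw [Nat.cast_choose ℚ hi]
    have := Nat.cast_ne_zero (R := ℚ).mpr n.factorial_ne_zero
    field_simp
  rw [coeff_egf, coeff_egf, smul_mul_smul_comm, h, mul_smul]
  simp [Algebra.smul_def]

theorem coeff_X_mul_egf (r : ℕ → k) (n : ℕ) : PowerSeries.coeff n (PowerSeries.X * egf r) =
    (1 / (n.factorial : ℚ)) • (n • r (n - 1)) := by
  rcases n with _ | n
  · simp
  · rw [PowerSeries.coeff_succ_X_mul, coeff_egf, Nat.add_sub_cancel, ← Nat.cast_smul_eq_nsmul ℚ,
      smul_smul, Nat.factorial_succ]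
    congr 1
    have := Nat.cast_ne_zero (R := ℚ).mpr n.factorial_ne_zero
    push_cast
    field_simp

theorem diffOp_rat_smul (g : PowerSeries k) (c : ℚ) (f : k[X]) :
    diffOp g (c • f) = c • diffOp g f :=
  map_rat_smul (diffOpHom g).toAddMonoidHom c f

theorem smul_one_div_factorial_cancel {n : ℕ} {a b : k}
    (h : (1 / (n.factorial : ℚ)) • a = (1 / (n.factorial : ℚ)) • b) : a = b := by
  have hn := Nat.cast_ne_zero (R := ℚ).mpr n.factorial_ne_zero
  have := congrArg (fun x => (n.factorial : ℚ) • x) h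
  simpa [smul_smul, hn] using this

/-- On exponential generating functions, passing to `n r_{n-1}` is multiplication by `z`. -/
theorem diffOp_seq_iff (g : PowerSeries k) (r : ℕ → k[X]) :
    (∀ n, diffOp g (r n) = n • r (n - 1)) ↔
      ∀ n, diffOp g (PowerSeries.coeff n (egf r)) =
        PowerSeries.coeff n (PowerSeries.X * egf r) := by
  refine forall_congr' fun n => ?_
  rw [coeff_X_mul_egf, coeff_egf, diffOp_rat_smul]
  exact ⟨fun h => by rw [h], smul_one_div_factorial_cancel⟩

namespace IsBinomialType

/-- At `x = y = 0` the binomial identity makes `∑ p_n(0) z^n/n!` idempotent. It is also a unit,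
since `p_0` is an invertible constant, hence it is `1`. -/
theorem coeff_zero (hp : IsBinomialType p) (n : ℕ) :
    (p n).coeff 0 = if n = 0 then 1 else 0 := by
  set c : ℕ → k := fun n => (p n).coeff 0 with hc
  have h : egf c * egf c = egf c := by
    rw [egf_mul]
    congr 1
    funext n
    have := hp.aeval_add (0 : k) 0 n
    simp only [add_zero, coe_aeval_eq_eval, ← coeff_zero_eq_eval_zero] at this
    exact this.symm
  have hu : IsUnit (egf c) := by
    rw [PowerSeries.isUnit_iff_constantCoeff, ← PowerSeries.coeff_zero_eq_constantCoeff_apply,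
      coeff_zero_egf]
    exact hp.1.isUnit_coeff 0
  have h1 : egf c = 1 := hu.mul_left_cancel (by rw [h, mul_one])
  have h2 := congrArg (PowerSeries.coeff n) h1
  rw [coeff_egf, PowerSeries.coeff_one] at h2
  refine smul_one_div_factorial_cancel (n := n) (h2.trans ?_)
  split_ifs with hn
  · simp [hn]
  · simp

theorem apply_zero (hp : IsBinomialType p) : p 0 = 1 := by
  rw [eq_C_of_natDegree_eq_zero (hp.1.natDegree 0), hp.coeff_zero, if_pos rfl, C_1]

/-- The series `f` with `∑ p_n(x) z ^ n / n! = e ^ (x f(z))`. -/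
def _root_.Umbral.exponent (p : ℕ → k[X]) : PowerSeries k := egf fun n => (p n).coeff 1

theorem constantCoeff_exponent (hp : IsBinomialType p) :
    PowerSeries.constantCoeff (exponent p) = 0 := by
  rw [← PowerSeries.coeff_zero_eq_constantCoeff_apply, exponent, coeff_zero_egf, hp.apply_zero,
    coeff_one, if_neg one_ne_zero]

theorem isUnit_coeff_one_exponent (hp : IsBinomialType p) :
    IsUnit (PowerSeries.coeff 1 (exponent p)) := by
  rw [exponent, coeff_egf]
  simpa using hp.1.isUnit_coeff 1

theorem derivEqMul (hp : IsBinomialType p) : DerivEqMul (exponent p) (egf p) := by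
  intro n
  rw [exponent, map_egf, mul_comm, egf_mul, coeff_egf, coeff_egf, ← hp.derivative]
  exact map_rat_smul (Polynomial.derivative (R := k)).toAddMonoidHom _ _

/-- The series `φ` for which `φ(D)` is the delta operator associated with `p`. -/
theorem exists_delta (hp : IsBinomialType p) : ∃ φ : PowerSeries k, IsDelta φ ∧
    PowerSeries.HasSubst φ ∧ φ.subst (exponent p) = PowerSeries.X ∧
    ∀ n, diffOp φ (p n) = n • p (n - 1) := by
  have hf := hp.constantCoeff_exponent
  have hu := hp.isUnit_coeff_one_exponent
  refine ⟨PowerSeries.substInvOfIsUnit _ hu, ⟨?_, ?_⟩, PowerSeries.HasSubst.substInvOfIsUnit _ hu,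
    PowerSeries.subst_substInvOfIsUnit_left _ hf hu, ?_⟩
  · rw [PowerSeries.coeff_zero_eq_constantCoeff_apply,
      PowerSeries.constantCoeff_substInvOfIsUnit]
  · rw [PowerSeries.coeff_one_substInvOfIsUnit]
    exact Units.isUnit _
  · rw [diffOp_seq_iff]
    intro n
    rw [hp.derivEqMul.diffOp hf, PowerSeries.subst_substInvOfIsUnit_left _ hf hu,
      PowerSeries.map_X]

/-- Sheffer sequences are the images of `p` under invertible shift-invariant operators. -/
theorem isSheffer_iff (hp : IsBinomialType p) : (IsSheffer p s ∧ s 0 = 1) ↔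
    ∃ b : ℕ → k, b 0 = 1 ∧ ∀ n, s n = diffOp (egf b) (p n) := by
  obtain ⟨φ, hφ, hsub, hφf, hφp⟩ := hp.exists_delta
  have hf := hp.constantCoeff_exponent
  constructor
  · rintro ⟨⟨-, g, hg, hgp, hgs⟩, h0⟩
    -- The sequence `r` with generating function `A(z) P(x, z)` is lowered by `g(D)` and, as `P(0,
    -- z) = 1`, has the same values at `0` as `s`. So `r = s`.
    set A : PowerSeries k := egf fun n => (s n).coeff 0 with hA
    set r : ℕ → k[X] := fun n =>
      (n.factorial : ℚ) • PowerSeries.coeff n (PowerSeries.map C A * egf p) with hr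
    have hegf : egf r = PowerSeries.map C A * egf p := egf_factorial_smul_coeff _
    have hgr : ∀ n, diffOp g (r n) = n • r (n - 1) := by
      rw [diffOp_seq_iff] at hgp ⊢
      intro n
      rw [hegf, mul_left_comm, PowerSeries.coeff_mul, PowerSeries.coeff_mul, diffOp_sum]
      refine Finset.sum_congr rfl fun x _ => ?_
      rw [PowerSeries.coeff_map, diffOp_C_mul, hgp]
    have hr0 : ∀ n, (r n).coeff 0 = (s n).coeff 0 := by
      have h1 : egf (fun n => (r n).coeff 0) = A := by
        have := map_egf (constantCoeff (R := k)) r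
        simp only [constantCoeff_apply] at this
        rw [← this, hegf, map_mul, map_egf _ p]
        have h2 : egf (fun n => constantCoeff (p n)) = 1 := by
          ext n
          rw [coeff_egf, constantCoeff_apply, hp.coeff_zero, PowerSeries.coeff_one]
          split_ifs with hn
          · simp [hn]
          · simp
        rw [h2, mul_one]
        ext n
        simp
      exact fun n => congrFun (egf_injective (h1.trans hA)) n
    have hrs := hg.seq_unique hgr hgs hr0
    -- Since `φ(f(z)) = z`, the operator `A(φ(D))` multiplies `P` by `A(z)`.
    refine ⟨fun n => (n.factorial : ℚ) • PowerSeries.coeff n (A.subst φ), ?_, fun n => ?_⟩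
    · have hφ0 : PowerSeries.constantCoeff φ = 0 := by
        rw [← PowerSeries.coeff_zero_eq_constantCoeff_apply, hφ.1]
      simp only [coeff_zero_subst hφ0, hA, coeff_zero_egf, h0]
      simp
    · rw [egf_factorial_smul_coeff]
      refine smul_one_div_factorial_cancel (n := n) ?_
      rw [← diffOp_rat_smul, ← coeff_egf p, hp.derivEqMul.diffOp hf,
        PowerSeries.subst_comp_subst_apply hsub (PowerSeries.HasSubst.of_constantCoeff_zero' hf),
        hφf, PowerSeries.X_subst, ← hegf, coeff_egf, hrs]
  · rintro ⟨b, hb, hs⟩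
    have hb' : PowerSeries.coeff 0 (egf b) = 1 := by rw [coeff_zero_egf, hb]
    obtain rfl : s = fun n => diffOp (egf b) (p n) := funext hs
    refine ⟨⟨hp.1.diffOp hb', φ, hφ, hφp, fun n => ?_⟩, ?_⟩
    · rw [diffOp_comm, hφp, diffOp_nsmul]
    · change diffOp (egf b) (p 0) = 1
      rw [hp.apply_zero, diffOp_one, hb', C_1]

/-- For `e^{f(z)}` as the series of `c`, both generating functions solve `D P = f(z) P` with `P(0,
z) = 1`. -/
theorem eq_dotPoly (hp : IsBinomialType p) :
    ∃ c : ℕ → k, c 0 = 1 ∧ ∀ n, p n = dotPoly (egf c) n := by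
  have hf := hp.constantCoeff_exponent
  refine ⟨fun n => (n.factorial : ℚ) • PowerSeries.coeff n
    ((PowerSeries.exp k).subst (exponent p)), ?_, fun n => ?_⟩
  · simp only [coeff_zero_subst hf]
    simp
  · refine congrFun (egf_injective ?_) n
    rw [egf_factorial_smul_coeff, egf_dotPoly, logOf_exp_subst hf]
    refine hp.derivEqMul.unique (derivEqMul_expMul hf) hf fun n => ?_
    rw [coeff_zero_coeff_expMul hf, coeff_egf, coeff_smul, hp.coeff_zero]
    split_ifs with hn
    · simp [hn]
    · simp

end IsBinomialType

namespace IsBinomialType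

/-- For `a` with series `1/ψ`, where `φ = tψ`, both sequences are lowered by `φ(D)` and agree at
`0`. -/
theorem eq_abelPoly (hp : IsBinomialType p) (h1 : p 1 = X) :
    ∃ a : ℕ → k, a 0 = 1 ∧ ∀ n, p n = abelPoly (egf a) n := by
  obtain ⟨φ, hφ, -, -, hφp⟩ := hp.exists_delta
  have hφ1 : PowerSeries.coeff 1 φ = 1 := hφ.coeff_one_eq (by
    rw [← h1, hφp, Nat.sub_self, one_smul, hp.apply_zero])
  obtain ⟨ψ, rfl⟩ : PowerSeries.X ∣ φ := PowerSeries.X_dvd_iff.mpr (by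
    rw [← PowerSeries.coeff_zero_eq_constantCoeff_apply, hφ.1])
  have hψ : PowerSeries.constantCoeff ψ = 1 := by
    rwa [PowerSeries.coeff_succ_X_mul 0, PowerSeries.coeff_zero_eq_constantCoeff_apply] at hφ1
  have hU := PowerSeries.mul_invOfUnit ψ 1 (by simpa using hψ)
  refine ⟨fun n => (n.factorial : ℚ) • PowerSeries.coeff n (PowerSeries.invOfUnit ψ 1), ?_, ?_⟩
  · simp
  · rw [egf_factorial_smul_coeff]
    exact hφ.seq_unique hφp (diffOp_abelPoly hU) fun n => by
      rw [hp.coeff_zero, coeff_zero_abelPoly]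

theorem eq_risingPoly (hp : IsBinomialType p) (h1 : p 1 = X) :
    ∃ m : ℕ → k, m 0 = 1 ∧ ∀ n, p n = risingPoly (egf m) n := by
  obtain ⟨φ, hφ, -, -, hφp⟩ := hp.exists_delta
  have hφ1 : PowerSeries.coeff 1 φ = 1 := hφ.coeff_one_eq (by
    rw [← h1, hφp, Nat.sub_self, one_smul, hp.apply_zero])
  set M := PowerSeries.invOfUnit (PowerSeries.derivative k φ) 1 with hM
  have hU : PowerSeries.derivative k φ * M = 1 :=
    PowerSeries.mul_invOfUnit _ 1 (by
      rw [← PowerSeries.coeff_zero_eq_constantCoeff_apply, PowerSeries.coeff_derivative]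
      simp [hφ1])
  refine ⟨fun n => (n.factorial : ℚ) • PowerSeries.coeff n M, ?_, ?_⟩
  · simp [hM]
  -- As `φ' M = 1`, the commutator gives `φ(D) x M p_n = n x M p_{n-1} + p_n`, which is `(n + 1)
  -- p_n` by the hypothesis. The factor `n` there makes the case `n = 0` vacuous.
  have hrec : ∀ n, n • (X * diffOp M (p (n - 1))) = n • p n → p (n + 1) = X * diffOp M (p n) := by
    intro n hn
    have h : diffOp φ (p (n + 1) - X * diffOp M (p n)) = 0 := by
      rw [diffOp_sub, hφp, diffOp_X_mul, ← diffOp_mul_left (PowerSeries.derivative k φ), hU,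
        diffOp_one_left, diffOp_comm, hφp, Nat.add_sub_cancel, diffOp_nsmul, mul_smul_comm, hn,
        succ_nsmul, sub_self]
    have := hφ.eq_C_of_diffOp_eq_zero h
    rwa [coeff_sub, hp.coeff_zero, if_neg n.succ_ne_zero, coeff_X_mul_zero, sub_self, C_0,
      sub_eq_zero] at this
  have hrec' : ∀ n, p (n + 1) = X * diffOp M (p n) := by
    intro n
    induction n with
    | zero => exact hrec 0 (by simp)
    | succ n ih => exact hrec _ (by rw [Nat.add_sub_cancel, ← ih])
  intro n
  rw [egf_factorial_smul_coeff]
  induction n with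
  | zero => rw [hp.apply_zero, risingPoly]
  | succ n ih => rw [hrec', ih, risingPoly]

end IsBinomialType

end BinomialType

/-! ### Umbrae in a shifted argument -/

section Evaluation

variable {A F : Type*} [CommRing F] {mom : A → ℕ → F}

/-- A power of an umbra is independent of the polynomials in the other umbrae. -/
theorem evalOf_mul_X_pow (h0 : ∀ a, mom a 0 = 1) {a : A} {u : MvPolynomial A F}
    (hu : u ∈ MvPolynomial.supported F {a}ᶜ) (n : ℕ) :
    evalOf mom (u * MvPolynomial.X a ^ n) = evalOf mom u * mom a n := by
  classical
  conv_lhs => rw [u.as_sum]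
  conv_rhs => rw [u.as_sum]
  rw [Finset.sum_mul, map_sum, map_sum, Finset.sum_mul]
  refine Finset.sum_congr rfl fun e he => ?_
  have hae : a ∉ e.support := fun ha =>
    MvPolynomial.mem_supported.mp hu
      ((MvPolynomial.mem_vars_iff_mem_support a).mpr ⟨e, he, ha⟩) rfl
  have hd : Disjoint e.support (Finsupp.single a n).support :=
    Finset.disjoint_of_subset_right Finsupp.support_single_subset
      (Finset.disjoint_singleton_right.mpr hae)
  rw [MvPolynomial.X_pow_eq_monomial, MvPolynomial.monomial_mul, evalOf_monomial, evalOf_monomial,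
    Finsupp.prod_add_index_of_disjoint hd, Finsupp.prod_single_index (h0 a)]
  ring

theorem evalOf_aeval_C (mom : A → ℕ → F) (c : F) (r : F[X]) :
    evalOf mom (aeval (MvPolynomial.C c) r) = r.eval c := by
  rw [← MvPolynomial.algebraMap_eq, aeval_algebraMap_apply, MvPolynomial.algebraMap_eq, evalOf_C,
    coe_aeval_eq_eval]

theorem C_mem_supported (S : Set A) (c : F) : MvPolynomial.C c ∈ MvPolynomial.supported F S :=
  (MvPolynomial.supported F S).algebraMap_mem c

theorem X_mem_supported_of_mem {S : Set A} {a : A} (h : a ∈ S) :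
    (MvPolynomial.X a : MvPolynomial A F) ∈ MvPolynomial.supported F S :=
  Algebra.subset_adjoin (Set.mem_image_of_mem _ h)

variable [Algebra ℚ F]

/-- Evaluation of an umbra `a` that occurs in a shift of the argument of a polynomial. -/
theorem evalOf_mul_aeval_add_X (h0 : ∀ a, mom a 0 = 1) {a : A} {u z : MvPolynomial A F}
    (hu : u ∈ MvPolynomial.supported F {a}ᶜ) (hz : z ∈ MvPolynomial.supported F {a}ᶜ) (r : F[X]) :
    evalOf mom (u * aeval (z + MvPolynomial.X a) r) =
      evalOf mom (u * aeval z (diffOp (egf (mom a)) r)) := by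
  induction r using Polynomial.induction_on' with
  | add r₁ r₂ h₁ h₂ => simp only [diffOp_add, map_add, mul_add, h₁, h₂]
  | monomial n c =>
    rw [← C_mul_X_pow_eq_monomial, diffOp_C_mul, diffOp_egf_X_pow]
    simp only [map_mul, aeval_C, map_pow, aeval_X, map_sum]
    rw [add_comm z, add_pow, Finset.mul_sum, Finset.mul_sum, Finset.mul_sum, Finset.mul_sum,
      map_sum, map_sum]
    refine Finset.sum_congr rfl fun i _ => ?_
    have e1 : u * (algebraMap F (MvPolynomial A F) c *
        (MvPolynomial.X a ^ i * z ^ (n - i) * (n.choose i : MvPolynomial A F))) =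
        (c * n.choose i) • ((u * z ^ (n - i)) * MvPolynomial.X a ^ i) := by
      rw [Algebra.smul_def, map_mul, map_natCast]
      ring
    have e2 : u * (algebraMap F (MvPolynomial A F) c *
        (algebraMap F (MvPolynomial A F) (mom a i) *
          algebraMap F (MvPolynomial A F) (n.choose i : F) * z ^ (n - i))) =
        (c * n.choose i) • (mom a i • (u * z ^ (n - i))) := by
      rw [Algebra.smul_def, Algebra.smul_def, map_mul, map_natCast]
      ring
    rw [e1, e2, map_smul, map_smul, map_smul, evalOf_mul_X_pow h0 (mul_mem hu (pow_mem hz _)),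
      smul_eq_mul, smul_eq_mul, smul_eq_mul]
    ring

theorem evalOf_aeval_C_add_X (h0 : ∀ a, mom a 0 = 1) (c : F) (a : A) (r : F[X]) :
    evalOf mom (aeval (MvPolynomial.C c + MvPolynomial.X a) r) =
      (diffOp (egf (mom a)) r).eval c := by
  have := evalOf_mul_aeval_add_X h0 (one_mem (MvPolynomial.supported F {a}ᶜ))
    (C_mem_supported {a}ᶜ c) r
  rwa [one_mul, one_mul, evalOf_aeval_C] at this

end Evaluation

/-! ### Evaluation of the three umbral presentations -/

section Alphabet

variable {F : Type*} [CommRing F]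

theorem const_mem_supported (S : Set (Umbra F ⊕ AuxUmbra F)) (c : F) :
    const c ∈ MvPolynomial.supported F S := C_mem_supported S c

theorem umb_mem_supported {S : Set (Umbra F ⊕ AuxUmbra F)} {a : Umbra F} (h : Sum.inl a ∈ S) :
    umb a ∈ MvPolynomial.supported F S := X_mem_supported_of_mem h

/-- Absorbing the first umbra into `z` matches the recursion of `risingPoly`. -/
theorem rising_succ (μ : ℕ → Umbra F) (z : UPoly F) (n : ℕ) :
    rising μ z (n + 1) = z * rising (fun i => μ (i + 1)) (z + umb (μ 0)) n := by
  rw [rising, Finset.prod_range_succ', mul_comm, rising]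
  congr 1
  · simp
  · refine Finset.prod_congr rfl fun j _ => ?_
    rw [Finset.sum_range_succ']
    ring

variable [Algebra ℚ F]

theorem genFun_X (α : Umbra F) : genFun (MvPolynomial.X α) = egf α.moment := by
  ext n
  rw [genFun, PowerSeries.coeff_mk, coeff_egf, eval₀, evalOf_X_pow _ Umbra.moment_zero]

theorem constantCoeff_genFun (q : MvPolynomial (Umbra F) F) :
    PowerSeries.constantCoeff (genFun q) = 1 := by
  rw [← PowerSeries.coeff_zero_eq_constantCoeff_apply, genFun, PowerSeries.coeff_mk, pow_zero,
    ← MvPolynomial.C_1, eval₀, evalOf_C]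
  simp

theorem AuxUmbra.moment_zero (d : AuxUmbra F) : d.moment 0 = 1 := by
  have h := coeff_expMul (PowerSeries.constantCoeff_logOf (constantCoeff_genFun d.right))
    Nat.zero_lt_one
  have h1 : dotPoly (genFun d.right) 0 = 1 := by
    rw [dotPoly_eq, h, Finset.sum_range_one, pow_zero, pow_zero, PowerSeries.coeff_zero_one]
    simp
  rw [AuxUmbra.moment, h1, map_one, ← MvPolynomial.C_1, eval₀, evalOf_C]

theorem elim_moment_zero (a : Umbra F ⊕ AuxUmbra F) :
    Sum.elim Umbra.moment AuxUmbra.moment a 0 = 1 := by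
  cases a with
  | inl a => exact a.moment_zero
  | inr d => exact d.moment_zero

theorem E_const (c : F) : E (const c) = c := evalOf_C _ c

theorem E_dot_pow (u v : MvPolynomial (Umbra F) F) (n : ℕ) :
    E (dot u v ^ n) = eval₀ (aeval u (dotPoly (genFun v) n)) :=
  evalOf_X_pow _ elim_moment_zero _ n

theorem E_dot_C_pow (c : F) (γ : Umbra F) (n : ℕ) :
    E (dot (MvPolynomial.C c) (MvPolynomial.X γ) ^ n) = (dotPoly (egf γ.moment) n).eval c := by
  rw [E_dot_pow, genFun_X, eval₀, evalOf_aeval_C]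

theorem E_dot_C_add_X_pow (c : F) (β γ : Umbra F) (n : ℕ) :
    E (dot (MvPolynomial.C c + MvPolynomial.X β) (MvPolynomial.X γ) ^ n) =
      (diffOp (egf β.moment) (dotPoly (egf γ.moment) n)).eval c := by
  rw [E_dot_pow, genFun_X, eval₀, evalOf_aeval_C_add_X Umbra.moment_zero]

theorem E_aeval_const (c : F) (r : F[X]) : E (aeval (const c) r) = r.eval c :=
  evalOf_aeval_C _ c r

theorem E_aeval_const_add_umb (c : F) (β : Umbra F) (r : F[X]) :
    E (aeval (const c + umb β) r) = (diffOp (egf β.moment) r).eval c :=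
  evalOf_aeval_C_add_X elim_moment_zero c (Sum.inl β) r

theorem constantCoeff_egf_moment (α : Umbra F) :
    PowerSeries.constantCoeff (egf α.moment) = 1 := by
  rw [← genFun_X, constantCoeff_genFun]

/-- So `n . α` acts like a sum of `n` independent copies of `α`. -/
theorem egf_moment_natDot (n : ℕ) (α : Umbra F) :
    egf (AuxUmbra.moment ⟨(n : MvPolynomial (Umbra F) F), MvPolynomial.X α⟩) =
      egf α.moment ^ n := by
  rw [← egf_eval_natCast_dotPoly (constantCoeff_egf_moment α)]
  congr 1
  funext j
  rw [AuxUmbra.moment, genFun_X, eval₀, ← map_natCast (MvPolynomial.C (R := F)), evalOf_aeval_C]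

theorem E_abel (α : Umbra F) {z : UPoly F}
    (hz : ∀ d : AuxUmbra F, z ∈ MvPolynomial.supported F {Sum.inr d}ᶜ) (n : ℕ) :
    E (abel α z n) = E (aeval z (abelPoly (egf α.moment) n)) := by
  rcases n with _ | n
  · rw [abel, abelPoly, map_one (aeval z)]
  · have h := evalOf_mul_aeval_add_X elim_moment_zero (hz ⟨(n + 1 : ℕ), MvPolynomial.X α⟩)
      (hz ⟨(n + 1 : ℕ), MvPolynomial.X α⟩) (X ^ n)
    rw [map_pow, aeval_X, Sum.elim_inr, egf_moment_natDot] at h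
    rw [abel, abelPoly, map_mul (aeval z), aeval_X]
    exact h

/-- The factor `u` collects the factors already peeled off, which share umbrae with `z` and so
cannot be evaluated separately. Once induction has eliminated the later umbrae, `μ 0` occurs only in
the shift `z + μ 0`. -/
theorem E_mul_rising (m : ℕ → F) (n : ℕ) (μ : ℕ → Umbra F) (hμ : Function.Injective μ)
    (hm : ∀ i, (μ i).moment = m) {u z : UPoly F}
    (hu : ∀ i, u ∈ MvPolynomial.supported F {Sum.inl (μ i)}ᶜ)
    (hz : ∀ i, z ∈ MvPolynomial.supported F {Sum.inl (μ i)}ᶜ) :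
    E (u * rising μ z n) = E (u * aeval z (risingPoly (egf m) n)) := by
  induction n generalizing μ u z with
  | zero => simp [rising, risingPoly]
  | succ n ih =>
    have hadd : ∀ i, z + umb (μ 0) ∈ MvPolynomial.supported F {Sum.inl (μ (i + 1))}ᶜ := fun i =>
      add_mem (hz _) (X_mem_supported_of_mem fun h =>
        absurd (hμ (Sum.inl_injective (Set.mem_singleton_iff.mp h))) (by omega))
    rw [rising_succ, ← mul_assoc, ih _ (fun i j h => Nat.succ_injective (hμ h)) (fun i => hm _)
      (fun i => mul_mem (hu _) (hz _)) hadd]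
    have h := evalOf_mul_aeval_add_X elim_moment_zero (mul_mem (hu 0) (hz 0)) (hz 0)
      (risingPoly (egf m) n)
    rw [Sum.elim_inl, hm] at h
    refine Eq.trans h ?_
    rw [risingPoly, map_mul (aeval z), aeval_X, mul_assoc]
    rfl

theorem E_rising {m : ℕ → F} {μ : ℕ → Umbra F} (hμ : Function.Injective μ)
    (hm : ∀ i, (μ i).moment = m) {z : UPoly F}
    (hz : ∀ i, z ∈ MvPolynomial.supported F {Sum.inl (μ i)}ᶜ) (n : ℕ) :
    E (rising μ z n) = E (aeval z (risingPoly (egf m) n)) := by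
  have := E_mul_rising m n μ hμ hm (fun i => one_mem _) hz
  rwa [one_mul, one_mul] at this

theorem exchangeable_umb_iff (α β : Umbra F) :
    Exchangeable (umb α) (umb β) ↔ α.moment = β.moment := by
  have h : ∀ (a : Umbra F) (n : ℕ), E (umb a ^ n) = a.moment n := fun a n =>
    evalOf_X_pow _ elim_moment_zero (Sum.inl a) n
  simp only [Exchangeable, UEquiv, h, funext_iff]

end Alphabet

/-! ### Moments in `k`, with the argument specialised to `x` -/

section ScalarUmbrae

variable {k : Type*} [CommRing k]

/-- The umbra over `k[x]` with label `l` that represents the sequence `m` in `k`. -/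
def Umbra.ofScalar (m : ℕ → k) (h : m 0 = 1) (l : ℕ) : Umbra k[X] where
  moment n := C (m n)
  moment_zero := by rw [h, C_1]
  label := l

theorem Umbra.isScalar_ofScalar (m : ℕ → k) (h : m 0 = 1) (l : ℕ) :
    (Umbra.ofScalar m h l).IsScalar := fun n => ⟨m n, rfl⟩

theorem Umbra.IsScalar.exists_moment_eq {a : Umbra k[X]} (ha : a.IsScalar) :
    ∃ m : ℕ → k, m 0 = 1 ∧ a.moment = fun n => C (m n) := by
  choose m hm using ha
  refine ⟨m, C_injective ?_, funext hm⟩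
  rw [← hm, a.moment_zero, C_1]

theorem map_abelPoly {R : Type*} [CommRing R] (φ : k →+* R) (g : PowerSeries k) (n : ℕ) :
    (abelPoly g n).map φ = abelPoly (PowerSeries.map φ g) n := by
  cases n with
  | zero => simp [abelPoly]
  | succ n =>
    rw [abelPoly, abelPoly, Polynomial.map_mul, map_X, map_diffOp, Polynomial.map_pow, map_X,
      map_pow]

theorem map_risingPoly {R : Type*} [CommRing R] (φ : k →+* R) (g : PowerSeries k) (n : ℕ) :
    (risingPoly g n).map φ = risingPoly (PowerSeries.map φ g) n := by
  induction n with
  | zero => simp [risingPoly]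
  | succ n ih =>
    rw [risingPoly, risingPoly, Polynomial.map_mul, map_X, map_diffOp, ih]

/-- The umbral ground ring is `F = k[x]`; polynomials over `F` with coefficients from `k` return to
`k[x]` on evaluation at the element `x` of `F`. -/
theorem eval_X_map_C (q : k[X]) : (q.map C).eval X = q := by
  rw [eval_map, eval₂_C_X]

variable [Algebra ℚ k]

theorem eval_X_diffOp_egf {b : ℕ → k} (q : k[X]) :
    (diffOp (egf fun n => C (b n)) (q.map C)).eval X = diffOp (egf b) q := by
  rw [← map_egf, ← map_diffOp, eval_X_map_C]

variable {α β γ : Umbra k[X]} {a b c : ℕ → k}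

theorem E_dot_X_pow (hc : c 0 = 1) (hγ : γ.moment = fun n => C (c n)) (n : ℕ) :
    E (dot (MvPolynomial.C X) (MvPolynomial.X γ) ^ n) = dotPoly (egf c) n := by
  have h : PowerSeries.constantCoeff (egf c) = 1 := by
    rw [← PowerSeries.coeff_zero_eq_constantCoeff_apply, coeff_zero_egf, hc]
  rw [E_dot_C_pow, hγ, ← map_egf, ← map_dotPoly C h, eval_X_map_C]

theorem E_dot_X_add_pow (hc : c 0 = 1) (hγ : γ.moment = fun n => C (c n))
    (hβ : β.moment = fun n => C (b n)) (n : ℕ) :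
    E (dot (MvPolynomial.C X + MvPolynomial.X β) (MvPolynomial.X γ) ^ n) =
      diffOp (egf b) (dotPoly (egf c) n) := by
  have h : PowerSeries.constantCoeff (egf c) = 1 := by
    rw [← PowerSeries.coeff_zero_eq_constantCoeff_apply, coeff_zero_egf, hc]
  rw [E_dot_C_add_X_pow, hγ, hβ, ← map_egf _ c, ← map_dotPoly C h, eval_X_diffOp_egf]

theorem E_abel_X (hα : α.moment = fun n => C (a n)) (n : ℕ) :
    E (abel α (const X) n) = abelPoly (egf a) n := by
  rw [E_abel α fun d => const_mem_supported _ _, E_aeval_const, hα, ← map_egf, ← map_abelPoly,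
    eval_X_map_C]

theorem E_abel_X_add (hα : α.moment = fun n => C (a n)) (hβ : β.moment = fun n => C (b n))
    (n : ℕ) : E (abel α (const X + umb β) n) = diffOp (egf b) (abelPoly (egf a) n) := by
  rw [E_abel α fun d => add_mem (const_mem_supported _ _) (umb_mem_supported (by simp)),
    E_aeval_const_add_umb, hα, hβ, ← map_egf _ a, ← map_abelPoly, eval_X_diffOp_egf]

variable {μ : ℕ → Umbra k[X]}

theorem E_rising_X (hμ : Function.Injective μ) (hm : ∀ i, (μ i).moment = fun n => C (a n))
    (n : ℕ) : E (rising μ (const X) n) = risingPoly (egf a) n := by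
  rw [E_rising hμ hm fun d => const_mem_supported _ _, E_aeval_const, ← map_egf, ← map_risingPoly,
    eval_X_map_C]

theorem E_rising_X_add (hμ : Function.Injective μ) (hm : ∀ i, (μ i).moment = fun n => C (a n))
    (hβ : β.moment = fun n => C (b n)) (hne : ∀ i, μ i ≠ β) (n : ℕ) :
    E (rising μ (const X + umb β) n) = diffOp (egf b) (risingPoly (egf a) n) := by
  rw [E_rising hμ hm fun i => add_mem (const_mem_supported _ _) (umb_mem_supported fun h =>
      hne i (Sum.inl_injective (Set.mem_singleton_iff.mp h)).symm),
    E_aeval_const_add_umb, hβ, ← map_egf _ a, ← map_risingPoly, eval_X_diffOp_egf]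

theorem const_uequiv_iff (q : k[X]) (u : UPoly k[X]) : const q ≃ᵤ u ↔ q = E u := by
  rw [UEquiv, E_const]

end ScalarUmbrae

end Umbral

end

/-! ### The main theorem -/

open Umbral in
theorem mainTheorem4 {k : Type*} [CommRing k] [Algebra ℚ k] (p s : ℕ → Polynomial k)
    (hp : IsBinomialType p) :
    ((IsSheffer p s ∧ s 0 = 1) ↔
      ∃ β γ : Umbra (Polynomial k), β.IsScalar ∧ γ.IsScalar ∧
        (∀ n, const (p n) ≃ᵤ
          dot (MvPolynomial.C Polynomial.X) (MvPolynomial.X γ) ^ n) ∧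
        (∀ n, const (s n) ≃ᵤ
          dot (MvPolynomial.C Polynomial.X + MvPolynomial.X β) (MvPolynomial.X γ) ^ n)) ∧
    ((IsSheffer p s ∧ s 0 = 1 ∧ p 1 = Polynomial.X) ↔
      ∃ β α : Umbra (Polynomial k), β.IsScalar ∧ α.IsScalar ∧
        (∀ n, const (p n) ≃ᵤ abel α (const Polynomial.X) n) ∧
        (∀ n, const (s n) ≃ᵤ abel α (const Polynomial.X + umb β) n)) ∧
    ((IsSheffer p s ∧ s 0 = 1 ∧ p 1 = Polynomial.X) ↔
      ∃ (β μ : Umbra (Polynomial k)) (μs : ℕ → Umbra (Polynomial k)),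
        β.IsScalar ∧ μ.IsScalar ∧
        Function.Injective μs ∧ (∀ i, Exchangeable (umb (μs i)) (umb μ)) ∧ (∀ i, μs i ≠ β) ∧
        (∀ n, const (p n) ≃ᵤ rising μs (const Polynomial.X) n) ∧
        (∀ n, const (s n) ≃ᵤ rising μs (const Polynomial.X + umb β) n)) := by
  simp only [const_uequiv_iff]
  refine ⟨⟨fun h => ?_, ?_⟩, ⟨fun ⟨hs, h0, h1⟩ => ?_, ?_⟩, ⟨fun ⟨hs, h0, h1⟩ => ?_, ?_⟩⟩
  · obtain ⟨b, hb, hsb⟩ := hp.isSheffer_iff.mp h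
    obtain ⟨c, hc, hpc⟩ := hp.eq_dotPoly
    refine ⟨.ofScalar b hb 0, .ofScalar c hc 0, Umbra.isScalar_ofScalar _ _ _,
      Umbra.isScalar_ofScalar _ _ _, fun n => ?_, fun n => ?_⟩
    · rw [E_dot_X_pow hc rfl, hpc]
    · rw [E_dot_X_add_pow hc rfl rfl, hsb, hpc]
  · rintro ⟨β, γ, hβ, hγ, hpn, hsn⟩
    obtain ⟨b, hb, hβ⟩ := hβ.exists_moment_eq
    obtain ⟨c, hc, hγ⟩ := hγ.exists_moment_eq
    refine hp.isSheffer_iff.mpr ⟨b, hb, fun n => ?_⟩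
    rw [hsn, hpn, E_dot_X_pow hc hγ, E_dot_X_add_pow hc hγ hβ]
  · obtain ⟨b, hb, hsb⟩ := hp.isSheffer_iff.mp ⟨hs, h0⟩
    obtain ⟨a, ha, hpa⟩ := hp.eq_abelPoly h1
    refine ⟨.ofScalar b hb 0, .ofScalar a ha 0, Umbra.isScalar_ofScalar _ _ _,
      Umbra.isScalar_ofScalar _ _ _, fun n => ?_, fun n => ?_⟩
    · rw [E_abel_X rfl, hpa]
    · rw [E_abel_X_add rfl rfl, hsb, hpa]
  · rintro ⟨β, α, hβ, hα, hpn, hsn⟩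
    obtain ⟨b, hb, hβ⟩ := hβ.exists_moment_eq
    obtain ⟨a, ha, hα⟩ := hα.exists_moment_eq
    rw [← and_assoc]
    refine ⟨hp.isSheffer_iff.mpr ⟨b, hb, fun n => ?_⟩, ?_⟩
    · rw [hsn, hpn, E_abel_X hα, E_abel_X_add hα hβ]
    -- For `n = 1` the Abel polynomial is `x (x + 1 . α)^0 = x`.
    · rw [hpn, abel, pow_zero, mul_one, E_const]
  · obtain ⟨b, hb, hsb⟩ := hp.isSheffer_iff.mp ⟨hs, h0⟩
    obtain ⟨m, hm, hpm⟩ := hp.eq_risingPoly h1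
    -- Label `0` is reserved for `β`, so the labels `i + 1` keep the `μ`s distinct from each other
    -- and from `β` even if moments coincide.
    have hinj : Function.Injective fun i => Umbra.ofScalar m hm (i + 1) := fun i j h =>
      Nat.succ_injective (congrArg Umbra.label h)
    have hne : ∀ i, Umbra.ofScalar m hm (i + 1) ≠ Umbra.ofScalar b hb 0 := fun i h =>
      i.succ_ne_zero (congrArg Umbra.label h)
    refine ⟨.ofScalar b hb 0, .ofScalar m hm 0, fun i => .ofScalar m hm (i + 1),
      Umbra.isScalar_ofScalar _ _ _, Umbra.isScalar_ofScalar _ _ _, hinj,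
      fun i => (exchangeable_umb_iff _ _).mpr rfl, hne, fun n => ?_, fun n => ?_⟩
    · rw [E_rising_X hinj fun _ => rfl, hpm]
    · rw [E_rising_X_add hinj (fun _ => rfl) rfl hne, hsb, hpm]
  · rintro ⟨β, μ, μs, hβ, hμ, hinj, hex, hne, hpn, hsn⟩
    obtain ⟨b, hb, hβ⟩ := hβ.exists_moment_eq
    obtain ⟨m, hm, hμ⟩ := hμ.exists_moment_eq
    have hμs : ∀ i, (μs i).moment = fun n => Polynomial.C (m n) := fun i =>
      ((exchangeable_umb_iff _ _).mp (hex i)).trans hμ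
    rw [← and_assoc]
    refine ⟨hp.isSheffer_iff.mpr ⟨b, hb, fun n => ?_⟩, ?_⟩
    · rw [hsn, hpn, E_rising_X hinj hμs, E_rising_X_add hinj hμs hβ hne]
    · rw [hpn, rising, Finset.prod_range_one, Finset.sum_range_zero, add_zero, E_const]
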